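/- Let $(X_1,X_2,X_3)$ and $(U_1,U_2,U_3)$ be two independent triples of real-valued random variables on a probability space $(\Omega,\mathcal A,P)$, with $(U_1,U_2,U_3)$ uniformly distributed on $(0,1)^3$. Let $F_3$ be the distribution function of $X_3$, and for $i=1,2$ let $F_{i|3}(\cdot\,|\,x)$ be a version of the conditional distribution function of $X_i$ given $X_3=x$, i.e. for $PX_3^{-1}$-almost every $x$ it is the distribution function of the regular conditional distribution of $X_i$ given $X_3=x$. Write $F(x-)$ for the left limit of $F$ at $x$, and assume that the four maps $(x_i,x_3)\mapsto F_{i|3}(x_i\,|\,x_3)$ and $(x_i,x_3)\mapsto F_{i|3}(x_i-\,|\,x_3)$, $i=1,2$, are Borel measurable on $\mathbb R^2$. Define the Brockwell transforms $$Z_{i|3}=(1-U_i)\,F_{i|3}(X_i-\,|\,X_3)+U_i\,F_{i|3}(X_i\,|\,X_3)\quad(i=1,2),\qquad Z_3=(1-U_3)\,F_3(X_3-)+U_3\,F_3(X_3).$$ A distribution function $F$ is said to satisfy the $\le$ well-ordering condition if its set of jumps $D_F=\{x\in\mathbb R: F(x-)<F(x)\}$ is well-ordered by the usual order $\le$ of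 $\mathbb R$. Then: 1. If $X_1$ and $X_2$ are conditionally independent given $X_3$, then $Z_{1|3},Z_{2|3},Z_3$ are mutually independent. 2. Conversely, suppose that $F_3$ satisfies the $\le$ well-ordering condition and that, for $PX_3^{-1}$-almost every $x\in\mathbb R$, both $F_{1|3}(\cdot\,|\,x)$ and $F_{2|3}(\cdot\,|\,x)$ satisfy it. If $Z_{1|3},Z_{2|3},Z_3$ are mutually independent, then $X_1$ and $X_2$ are conditionally independent given $X_3$. -/

import Mathlib

open MeasureTheory ProbabilityTheory Set

noncomputable section

namespace Brockwell

/-- The left limit `F(x-)`. -/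
def leftLimit (F : ℝ → ℝ) (x : ℝ) : ℝ := Function.leftLim F x

/-- The set `D_F` of (jump) discontinuities of a distribution function `F`. -/
def jumpSet (F : ℝ → ℝ) : Set ℝ := {x | leftLimit F x < F x}

/-- The `≤` well-ordering condition: the set of jumps of `F` is well-ordered by the usual order
of the real line (for a subset of a linear order this is well-foundedness of `<`, i.e. every
nonempty subset has a least element). -/
def WellOrderingCondition (F : ℝ → ℝ) : Prop := (jumpSet F).IsWF

/-- The value `(1 - u) F(x-) + u F(x)` of the Brockwell transform with distribution function `F`. -/
def transform (F : ℝ → ℝ) (x u : ℝ) : ℝ := (1 - u) * leftLimit F x + u * F x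

variable {Ω : Type*} [MeasurableSpace Ω]

/-- The distribution function of a real random variable `X`. -/
def distFun (P : Measure Ω) (X : Ω → ℝ) : ℝ → ℝ := fun x => cdf (P.map X) x

/-- `F` (written `F x y` for `F(x | y)`) is a conditional distribution function of `X` given `Y`:
for almost every `y` (with respect to the law of `Y`), `F(· | y)` is the distribution function of
the regular conditional distribution of `X` given `Y = y`. Since regular conditional distributions
are unique up to null sets, this covers every version; the values on a null set of `y` are
unrestricted. -/
def IsCondDistFun (P : Measure Ω) [IsProbabilityMeasure P] (X Y : Ω → ℝ) (F : ℝ → ℝ → ℝ) : Prop :=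
  ∀ᵐ y ∂(P.map Y), ∀ x, F x y = cdf (condDistrib X Y P y) x

/-- `X` and `Y` are conditionally independent given `W`:
`P(X ∈ A, Y ∈ B | W) = P(X ∈ A | W) P(Y ∈ B | W)` almost surely, for all Borel sets `A`, `B`.
(Mathlib's `CondIndepFun` requires a standard Borel sample space.) -/
def CondIndepGiven (P : Measure Ω) (X Y W : Ω → ℝ) : Prop :=
  ∀ A B : Set ℝ, MeasurableSet A → MeasurableSet B →
    P⟦X ⁻¹' A ∩ Y ⁻¹' B | MeasurableSpace.comap W inferInstance⟧ =ᵐ[P]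
      fun ω => (P⟦X ⁻¹' A | MeasurableSpace.comap W inferInstance⟧) ω *
        (P⟦Y ⁻¹' B | MeasurableSpace.comap W inferInstance⟧) ω

/-- The Brockwell transform of `X` given `Y`, randomized by `U`. -/
def condBrockwell (F : ℝ → ℝ → ℝ) (X Y U : Ω → ℝ) : Ω → ℝ :=
  fun ω => transform (fun x => F x (Y ω)) (X ω) (U ω)

/-- The Brockwell transform of `X`, randomized by `U`. -/
def brockwell (P : Measure Ω) (X U : Ω → ℝ) : Ω → ℝ :=
  fun ω => transform (distFun P X) (X ω) (U ω)

end Brockwell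

end

/-!
Fix a kernel `κ` giving the conditional law of `X` given `V`, and let `Z` be the corresponding
Brockwell transform. Conditionally on `V = v`, the variable `Z` is uniform, and `X` is almost
surely the `Z`-quantile of `κ v`. So `Z` is uniform and independent of `V`, and, conversely,
whenever `Z` is independent of some `V'` of which `V` is a function, `X` is drawn from `κ V`
conditionally on `V'`.

With `V = X₃` and `V' = (X₃, X₂)` this says that `X₁` and `X₂` are conditionally independent given
`X₃` if and only if `Z₁` is independent of `(X₃, X₂)`. Up to randomization by `(U₂, U₃)`, which is
independent of everything else, `(Z₂, Z₃)` and `(X₃, X₂)` are functions of each other, so the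
latter pair may be replaced by the former. Finally, `Z₂` is independent of `X₃` and hence of `Z₃`.
-/

noncomputable section

namespace Brockwell

open Filter Topology

/-- The uniform distribution on `(0, 1)`, the law of the randomizing variables. -/
abbrev unif : Measure ℝ := volume.restrict (Ioo (0 : ℝ) 1)

instance unif_isProbabilityMeasure : IsProbabilityMeasure unif :=
  ⟨by simp⟩

lemma unif_ae_mem : ∀ᵐ u ∂unif, u ∈ Ioo (0 : ℝ) 1 :=
  ae_restrict_mem measurableSet_Ioo

lemma unif_Iio {a : ℝ} (ha : a ≤ 1) : unif (Iio a) = ENNReal.ofReal a := by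
  rw [Measure.restrict_apply measurableSet_Iio, Iio_inter_Ioo, min_eq_left ha, Real.volume_Ioo,
    sub_zero]

lemma eq_unif_of_Iio {m : Measure ℝ} [IsProbabilityMeasure m]
    (h : ∀ z ∈ Ioo (0 : ℝ) 1, m (Iio z) = ENNReal.ofReal z) : m = unif := by
  have hof (a : ℝ) : Tendsto ENNReal.ofReal (𝓝 a) (𝓝 (ENNReal.ofReal a)) :=
    ENNReal.continuous_ofReal.tendsto a
  have h_zero {a : ℝ} (ha : a ≤ 0) : m (Iio a) = 0 := by
    rw [← nonpos_iff_eq_zero, ← ENNReal.ofReal_zero]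
    refine ge_of_tendsto ((hof 0).mono_left (nhdsWithin_le_nhds (s := Ioi 0))) ?_
    filter_upwards [Ioo_mem_nhdsGT one_pos] with z hz
    exact (measure_mono (Iio_subset_Iio (ha.trans hz.1.le))).trans (h z hz).le
  have h_one {a : ℝ} (ha : 1 ≤ a) : m (Iio a) = 1 := by
    refine le_antisymm prob_le_one ?_
    rw [← ENNReal.ofReal_one]
    refine le_of_tendsto ((hof 1).mono_left (nhdsWithin_le_nhds (s := Iio 1))) ?_
    filter_upwards [Ioo_mem_nhdsLT one_pos] with z hz
    exact (h z hz).ge.trans (measure_mono (Iio_subset_Iio (hz.2.le.trans ha)))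
  have h_Iio (a : ℝ) : m (Iio a) = unif (Iio a) := by
    rcases le_or_gt a 0 with h0 | h0
    · rw [h_zero h0, unif_Iio (h0.trans zero_le_one), ENNReal.ofReal_of_nonpos h0]
    rcases lt_or_ge a 1 with h1 | h1
    · rw [h a ⟨h0, h1⟩, unif_Iio h1.le]
    · refine (h_one h1).trans (le_antisymm ?_ prob_le_one)
      rw [← ENNReal.ofReal_one, ← unif_Iio le_rfl]
      exact measure_mono (Iio_subset_Iio h1)
  refine Measure.ext_of_Ici _ _ fun a => ?_
  rw [← compl_Iio, prob_compl_eq_one_sub measurableSet_Iio,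
    prob_compl_eq_one_sub measurableSet_Iio, h_Iio a]

/-- The quantile function of a probability measure on `ℝ`. Only its values on `(0, 1)` matter; it
is set to `0` elsewhere so that it depends measurably on the measure and the level. -/
def quantile (ν : Measure ℝ) : ℝ → ℝ :=
  (Ioo (0 : ℝ) 1).indicator fun z => sInf {t | z ≤ cdf ν t}

section Distribution

variable {ν : Measure ℝ}

lemma quantile_le_iff {z a : ℝ} (hz : z ∈ Ioo (0 : ℝ) 1) : quantile ν z ≤ a ↔ z ≤ cdf ν a := by
  set S : Set ℝ := {t | z ≤ cdf ν t}
  have hne : S.Nonempty :=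
    (((tendsto_cdf_atTop ν).eventually (lt_mem_nhds hz.2)).exists).imp fun _ h => h.le
  have hbdd : BddBelow S := by
    obtain ⟨b, hb⟩ := ((tendsto_cdf_atBot ν).eventually (gt_mem_nhds hz.1)).exists
    exact ⟨b, fun t ht => ((monotone_cdf ν).reflect_lt (hb.trans_le ht)).le⟩
  rw [quantile, indicator_of_mem hz]
  refine ⟨fun h => ?_, fun h => csInf_le hbdd h⟩
  have hright : Tendsto (cdf ν) (𝓝[>] a) (𝓝 (cdf ν a)) :=
    ((cdf ν).right_continuous a).tendsto.mono_left (nhdsWithin_mono a Ioi_subset_Ici_self)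
  refine ge_of_tendsto hright ?_
  filter_upwards [self_mem_nhdsWithin] with t (ht : a < t)
  obtain ⟨s, hs, hst⟩ := (csInf_lt_iff hbdd hne).1 (h.trans_lt ht)
  exact le_trans hs (monotone_cdf ν hst.le)

lemma le_cdf_quantile {z : ℝ} (hz : z ∈ Ioo (0 : ℝ) 1) : z ≤ cdf ν (quantile ν z) :=
  (quantile_le_iff hz).1 le_rfl

lemma measurable_quantile_kernel {β : Type*} [MeasurableSpace β] (κ : Kernel β ℝ)
    [IsMarkovKernel κ] : Measurable fun p : β × ℝ => quantile (κ p.1) p.2 := by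
  have hcdf (a : ℝ) : Measurable fun p : β × ℝ => cdf (κ p.1) a := by
    simp_rw [cdf_eq_real, measureReal_def]
    exact ((κ.measurable_coe measurableSet_Iic).comp measurable_fst).ennreal_toReal
  have hIoo : MeasurableSet {p : β × ℝ | p.2 ∈ Ioo (0 : ℝ) 1} := measurable_snd measurableSet_Ioo
  refine measurable_of_Iic fun a => ?_
  have hset : (fun p : β × ℝ => quantile (κ p.1) p.2) ⁻¹' Iic a =
      {p | p.2 ∈ Ioo (0 : ℝ) 1}.ite {p | p.2 ≤ cdf (κ p.1) a} {_p | 0 ≤ a} := by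
    ext p
    by_cases hp : p.2 ∈ Ioo (0 : ℝ) 1
    · simp only [Set.ite, mem_preimage, mem_Iic, quantile_le_iff hp, mem_union, mem_inter_iff,
        Set.mem_sdiff, mem_ofPred_eq, hp, and_true, not_true_eq_false, and_false, or_false]
    · simp only [Set.ite, mem_preimage, mem_Iic, quantile, indicator_of_notMem hp, mem_union,
        mem_inter_iff, Set.mem_sdiff, mem_ofPred_eq, hp, and_false, not_false_eq_true, and_true,
        false_or]
  rw [hset]
  exact hIoo.ite (measurableSet_le measurable_snd (hcdf a)) (MeasurableSet.const _)

lemma leftLimit_cdf_quantile_le {z : ℝ} (hz : z ∈ Ioo (0 : ℝ) 1) :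
    leftLimit (cdf ν) (quantile ν z) ≤ z := by
  refine le_of_tendsto ((monotone_cdf ν).tendsto_leftLim _) ?_
  filter_upwards [self_mem_nhdsWithin] with t (ht : t < quantile ν z)
  exact (not_le.1 (mt (quantile_le_iff hz).2 ht.not_ge)).le

lemma leftLimit_cdf_le_cdf (x : ℝ) : leftLimit (cdf ν) x ≤ cdf ν x :=
  (monotone_cdf ν).leftLim_le le_rfl

lemma leftLimit_le_transform_cdf {x u : ℝ} (hu : u ∈ Ioo (0 : ℝ) 1) :
    leftLimit (cdf ν) x ≤ transform (cdf ν) x u := by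
  have := mul_le_mul_of_nonneg_left (leftLimit_cdf_le_cdf (ν := ν) x) hu.1.le
  rw [transform]
  linarith

lemma transform_cdf_le_cdf {x u : ℝ} (hu : u ∈ Ioo (0 : ℝ) 1) :
    transform (cdf ν) x u ≤ cdf ν x := by
  have := mul_le_mul_of_nonneg_left (leftLimit_cdf_le_cdf (ν := ν) x) (sub_nonneg.2 hu.2.le)
  rw [transform]
  linarith

lemma transform_cdf_lt_iff {x u z : ℝ} (hu : u ∈ Ioo (0 : ℝ) 1) (hz : z ∈ Ioo (0 : ℝ) 1) :
    transform (cdf ν) x u < z ↔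
      x < quantile ν z ∨ x = quantile ν z ∧ transform (cdf ν) (quantile ν z) u < z := by
  rcases lt_trichotomy x (quantile ν z) with hx | rfl | hx
  · have : cdf ν x < z := not_le.1 (mt (quantile_le_iff hz).2 hx.not_ge)
    simp only [hx, true_or, iff_true]
    exact (transform_cdf_le_cdf hu).trans_lt this
  · simp only [lt_irrefl, true_and, false_or]
  · have : z ≤ transform (cdf ν) x u := (le_cdf_quantile hz).trans
      (((monotone_cdf ν).le_leftLim hx).trans (leftLimit_le_transform_cdf hu))
    simp only [this.not_gt, hx.not_gt, hx.ne', false_and, or_self]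

lemma measurable_transform_cdf : Measurable fun p : ℝ × ℝ => transform (cdf ν) p.1 p.2 := by
  have hF : Measurable (cdf ν) := (monotone_cdf ν).measurable
  have hF' : Measurable (leftLimit (cdf ν)) := (monotone_cdf ν).leftLim.measurable
  unfold transform
  fun_prop

variable [IsProbabilityMeasure ν]

lemma measurable_quantile : Measurable (quantile ν) :=
  (measurable_quantile_kernel (Kernel.const Unit ν)).comp (measurable_prodMk_left (x := ()))

lemma leftLimit_cdf (x : ℝ) : leftLimit (cdf ν) x = ν.real (Iio x) := by
  have h := (cdf ν).measure_Iio (tendsto_cdf_atBot ν) x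
  rw [measure_cdf, sub_zero] at h
  rw [measureReal_def, h, ENNReal.toReal_ofReal]
  · rfl
  · exact (cdf_nonneg ν (x - 1)).trans ((monotone_cdf ν).le_leftLim (sub_one_lt x))

lemma measure_singleton_mul_unif_transform_cdf_lt {x z : ℝ} (hz : z ≤ cdf ν x) :
    ν {x} * unif {u | transform (cdf ν) x u < z} =
      ENNReal.ofReal (z - leftLimit (cdf ν) x) := by
  set d := cdf ν x - leftLimit (cdf ν) x with hd_def
  have hν : ν {x} = ENNReal.ofReal d := by
    conv_lhs => rw [← measure_cdf ν]
    exact (cdf ν).measure_singleton x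
  rcases (leftLimit_cdf_le_cdf (ν := ν) x).eq_or_lt with h | h
  · rw [hν, hd_def, ← h, sub_self, ENNReal.ofReal_zero, zero_mul,
      ENNReal.ofReal_of_nonpos (by linarith)]
  · have hd : 0 < d := sub_pos.2 h
    have hset : {u | transform (cdf ν) x u < z} = Iio ((z - leftLimit (cdf ν) x) / d) := by
      ext u
      rw [mem_ofPred_eq, mem_Iio, lt_div_iff₀ hd, transform]
      constructor <;> intro h <;> linarith
    rw [hν, hset, unif_Iio ((div_le_one hd).2 (sub_le_sub_right hz _)),
      ← ENNReal.ofReal_mul hd.le, mul_div_cancel₀ _ hd.ne']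

variable (ν)

lemma map_transform_cdf : (ν.prod unif).map (fun p => transform (cdf ν) p.1 p.2) = unif := by
  have : IsProbabilityMeasure ((ν.prod unif).map fun p => transform (cdf ν) p.1 p.2) :=
    Measure.isProbabilityMeasure_map measurable_transform_cdf.aemeasurable
  refine eq_unif_of_Iio fun z hz => ?_
  set q := quantile ν z
  set S : Set ℝ := {u | transform (cdf ν) q u < z}
  have hS : MeasurableSet S :=
    (measurable_transform_cdf.comp measurable_prodMk_left) measurableSet_Iio
  have hset : (fun p : ℝ × ℝ => transform (cdf ν) p.1 p.2) ⁻¹' Iio z =ᵐ[ν.prod unif]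
      (Iio q ×ˢ univ ∪ {q} ×ˢ S : Set (ℝ × ℝ)) := by
    refine eventuallyEq_set.2 ?_
    filter_upwards [Measure.quasiMeasurePreserving_snd.ae unif_ae_mem] with p hp
    simpa [q, S] using transform_cdf_lt_iff hp hz
  have hdisj : Disjoint (Iio q ×ˢ (univ : Set ℝ)) ({q} ×ˢ S) :=
    disjoint_prod.2 (Or.inl (by simp))
  calc (ν.prod unif).map (fun p => transform (cdf ν) p.1 p.2) (Iio z)
      = (ν.prod unif) (Iio q ×ˢ univ ∪ {q} ×ˢ S) := by
        rw [Measure.map_apply measurable_transform_cdf measurableSet_Iio, measure_congr hset]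
    _ = ν (Iio q) + ν {q} * unif S := by
        rw [measure_union hdisj ((measurableSet_singleton q).prod hS), Measure.prod_prod,
          Measure.prod_prod, measure_univ, mul_one]
    _ = ENNReal.ofReal (leftLimit (cdf ν) q) + ENNReal.ofReal (z - leftLimit (cdf ν) q) := by
        rw [measure_singleton_mul_unif_transform_cdf_lt (le_cdf_quantile hz), leftLimit_cdf,
          ofReal_measureReal]
    _ = ENNReal.ofReal z := by
        rw [← ENNReal.ofReal_add _ (sub_nonneg.2 (leftLimit_cdf_quantile_le hz)),
          add_sub_cancel]
        exact leftLimit_cdf (ν := ν) q ▸ measureReal_nonneg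

lemma ae_transform_cdf {p : ℝ → Prop} (hp : ∀ᵐ z ∂unif, p z) :
    ∀ᵐ r ∂ν.prod unif, p (transform (cdf ν) r.1 r.2) := by
  rw [← map_transform_cdf ν] at hp
  exact ae_of_ae_map measurable_transform_cdf.aemeasurable hp

lemma ae_quantile_transform_cdf :
    ∀ᵐ p ∂ν.prod unif, quantile ν (transform (cdf ν) p.1 p.2) = p.1 := by
  have h_ne : ∀ᵐ z ∂unif, ∀ a : ℚ, z ≠ cdf ν a := ae_all_iff.2 fun a => Measure.ae_ne unif _
  filter_upwards [ae_transform_cdf ν h_ne, ae_transform_cdf ν unif_ae_mem,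
    Measure.quasiMeasurePreserving_snd.ae unif_ae_mem] with p hne hz hu
  refine le_antisymm ((quantile_le_iff hz).2 (transform_cdf_le_cdf hu)) ?_
  by_contra! hlt
  -- At a rational `a` strictly between the quantile and `p.1`, the value `cdf ν a` is the transform
  -- itself, and the uniform distribution does not charge this countable set of values.
  obtain ⟨a, hqa, hax⟩ := exists_rat_btwn hlt
  refine hne a (le_antisymm ((quantile_le_iff hz).1 hqa.le) ?_)
  exact ((monotone_cdf ν).le_leftLim hax).trans (leftLimit_le_transform_cdf hu)

lemma map_quantile : unif.map (quantile ν) = ν := by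
  calc unif.map (quantile ν)
      = (ν.prod unif).map fun p => quantile ν (transform (cdf ν) p.1 p.2) := by
        conv_lhs => rw [← map_transform_cdf ν]
        exact Measure.map_map measurable_quantile measurable_transform_cdf
    _ = (ν.prod unif).map Prod.fst := Measure.map_congr (ae_quantile_transform_cdf ν)
    _ = ν := Measure.fst_prod

end Distribution

section Independence

variable {Ω : Type*} [MeasurableSpace Ω] {P : Measure Ω} {α β γ : Type*}
  [MeasurableSpace α] [MeasurableSpace β] [MeasurableSpace γ]

lemma map_eq_and_indepFun_of_map_prodMk_eq_prod [IsFiniteMeasure P] {X : Ω → α} {Y : Ω → β}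
    {μ : Measure α} {ν : Measure β} [IsProbabilityMeasure μ] [IsProbabilityMeasure ν]
    (hX : Measurable X) (hY : Measurable Y) (h : P.map (fun ω => (X ω, Y ω)) = μ.prod ν) :
    P.map X = μ ∧ P.map Y = ν ∧ IndepFun X Y P := by
  have hμ : P.map X = μ := by rw [← Measure.fst_map_prodMk hY, h, Measure.fst_prod]
  have hν : P.map Y = ν := by rw [← Measure.snd_map_prodMk hX, h, Measure.snd_prod]
  refine ⟨hμ, hν, ?_⟩
  rw [indepFun_iff_map_prod_eq_prod_map_map hX.aemeasurable hY.aemeasurable, h, hμ, hν]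

lemma indepFun_prodMk_right [IsFiniteMeasure P] {X : Ω → α} {Y : Ω → β} {Z : Ω → γ}
    (hX : Measurable X) (hY : Measurable Y) (hZ : Measurable Z) (hXY : IndepFun X Y P)
    (hXYZ : IndepFun (fun ω => (X ω, Y ω)) Z P) : IndepFun X (fun ω => (Y ω, Z ω)) P := by
  have hYZ : IndepFun Y Z P := hXYZ.comp measurable_snd measurable_id
  rw [indepFun_iff_map_prod_eq_prod_map_map hX.aemeasurable (hY.prodMk hZ).aemeasurable,
    hYZ.map_prod_eq_prod_map_map hY.aemeasurable hZ.aemeasurable]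
  rw [← Measure.prodAssoc_prod, ← hXY.map_prod_eq_prod_map_map hX.aemeasurable hY.aemeasurable,
    ← hXYZ.map_prod_eq_prod_map_map (hX.prodMk hY).aemeasurable hZ.aemeasurable,
    Measure.map_map MeasurableEquiv.prodAssoc.measurable ((hX.prodMk hY).prodMk hZ)]
  rfl

/-- Here `N` is a noise, `f (Y, N)` a randomization of `Y`, and `g` recovers `Y` from it. -/
lemma indepFun_randomization_iff [IsFiniteMeasure P] {δ : Type*} [MeasurableSpace δ] {X : Ω → α}
    {Y : Ω → β} {N : Ω → γ} {f : β × γ → δ} {g : δ → β} (hX : Measurable X) (hY : Measurable Y)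
    (hN : Measurable N) (hf : Measurable f) (hg : Measurable g)
    (hXYN : IndepFun (fun ω => (X ω, Y ω)) N P) (hgf : ∀ᵐ ω ∂P, g (f (Y ω, N ω)) = Y ω) :
    IndepFun X (fun ω => f (Y ω, N ω)) P ↔ IndepFun X Y P := by
  constructor
  · intro h
    exact (h.comp measurable_id hg).congr EventuallyEq.rfl hgf
  · intro h
    exact (indepFun_prodMk_right hX hY hN h hXYN).comp measurable_id hf

lemma iIndepFun_vec_three_iff [IsProbabilityMeasure P] {X₁ X₂ X₃ : Ω → α} (h₁ : Measurable X₁)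
    (h₂ : Measurable X₂) (h₃ : Measurable X₃) :
    iIndepFun ![X₁, X₂, X₃] P ↔
      IndepFun X₁ (fun ω => (X₂ ω, X₃ ω)) P ∧ IndepFun X₂ X₃ P := by
  have hm : ∀ i, Measurable (![X₁, X₂, X₃] i) := by
    intro i
    fin_cases i <;> assumption
  have (i : Fin 3) : IsProbabilityMeasure (P.map (![X₁, X₂, X₃] i)) :=
    Measure.isProbabilityMeasure_map (hm i).aemeasurable
  constructor
  · intro h
    exact ⟨(h.indepFun_prodMk hm 1 2 0 (by decide) (by decide)).symm,
      h.indepFun (i := 1) (j := 2) (by decide)⟩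
  · rintro ⟨h₁₂₃, h₂₃⟩
    rw [iIndepFun_iff_map_fun_eq_pi_map fun i => (hm i).aemeasurable]
    refine (Measure.pi_eq fun s hs => ?_).symm
    rw [Measure.map_apply (measurable_pi_lambda _ hm) (MeasurableSet.univ_pi hs),
      Fin.prod_univ_three, mul_assoc]
    have hpre : (fun ω i => ![X₁, X₂, X₃] i ω) ⁻¹' univ.pi s =
        X₁ ⁻¹' s 0 ∩ (fun ω => (X₂ ω, X₃ ω)) ⁻¹' (s 1 ×ˢ s 2) := by
      ext ω
      simp [Fin.forall_fin_succ]
    rw [hpre, h₁₂₃.measure_inter_preimage_eq_mul _ _ (hs 0) ((hs 1).prod (hs 2)),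
      mk_preimage_prod, h₂₃.measure_inter_preimage_eq_mul _ _ (hs 1) (hs 2),
      ← Measure.map_apply h₁ (hs 0), ← Measure.map_apply h₂ (hs 1),
      ← Measure.map_apply h₃ (hs 2)]
    rfl

end Independence

section KernelBrockwell

variable {Ω : Type*} [MeasurableSpace Ω] {β γ : Type*} [MeasurableSpace β] [MeasurableSpace γ]

/-- The Brockwell transform of `X` given `V`, randomized by `U`, where the conditional
distribution function of `X` given `V = v` is that of `κ v`. -/
def kernelBrockwell (κ : Kernel β ℝ) (V : Ω → β) (X U : Ω → ℝ) : Ω → ℝ :=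
  fun ω => transform (cdf (κ (V ω))) (X ω) (U ω)

lemma measurable_transform_kernel (κ : Kernel β ℝ) [IsMarkovKernel κ] :
    Measurable fun p : β × ℝ × ℝ => transform (cdf (κ p.1)) p.2.1 p.2.2 := by
  have h_real {s : Set (ℝ × ℝ)} (hs : MeasurableSet s) :
      Measurable fun q : β × ℝ => (κ q.1).real (Prod.mk q.2 ⁻¹' s) := by
    have hs' : MeasurableSet {r : (β × ℝ) × ℝ | (r.1.2, r.2) ∈ s} :=
      hs.preimage (measurable_fst.snd.prodMk measurable_snd)
    exact (Kernel.measurable_kernel_prodMk_left (κ := κ.prodMkRight ℝ) hs').ennreal_toReal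
  have hF : Measurable fun q : β × ℝ => cdf (κ q.1) q.2 := by
    simp_rw [cdf_eq_real]
    exact h_real (measurableSet_le measurable_snd measurable_fst)
  have hF' : Measurable fun q : β × ℝ => leftLimit (cdf (κ q.1)) q.2 := by
    simp_rw [leftLimit_cdf]
    exact h_real (measurableSet_lt measurable_snd measurable_fst)
  have hq : Measurable fun p : β × ℝ × ℝ => (p.1, p.2.1) := by fun_prop
  have hFq := hF.comp hq
  have hFq' := hF'.comp hq
  unfold transform
  fun_prop

lemma measurable_kernelBrockwell (κ : Kernel β ℝ) [IsMarkovKernel κ] {V : Ω → β} {X U : Ω → ℝ}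
    (hV : Measurable V) (hX : Measurable X) (hU : Measurable U) :
    Measurable (kernelBrockwell κ V X U) :=
  (measurable_transform_kernel κ).comp (hV.prodMk (hX.prodMk hU))

lemma map_prodMk_transform_cdf (μ : Measure β) [SFinite μ] (κ : Kernel β ℝ) [IsMarkovKernel κ] :
    (μ ⊗ₘ (κ ×ₖ Kernel.const β unif)).map
      (fun p => (p.1, transform (cdf (κ p.1)) p.2.1 p.2.2)) = μ.prod unif := by
  have hm : Measurable fun p : β × ℝ × ℝ => (p.1, transform (cdf (κ p.1)) p.2.1 p.2.2) :=
    measurable_fst.prodMk (measurable_transform_kernel κ)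
  ext s hs
  rw [Measure.map_apply hm hs, Measure.compProd_apply (hm hs), Measure.prod_apply hs]
  refine lintegral_congr fun v => ?_
  rw [Kernel.prod_apply, Kernel.const_apply]
  nth_rewrite 2 [← map_transform_cdf (κ v)]
  rw [Measure.map_apply measurable_transform_cdf (measurable_prodMk_left hs)]
  rfl

lemma map_prodMk_quantile (μ : Measure β) [SFinite μ] (κ : Kernel β ℝ) [IsMarkovKernel κ] :
    (μ.prod unif).map (fun p => (p.1, quantile (κ p.1) p.2)) = μ ⊗ₘ κ := by
  have hm : Measurable fun p : β × ℝ => (p.1, quantile (κ p.1) p.2) :=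
    measurable_fst.prodMk (measurable_quantile_kernel κ)
  ext s hs
  rw [Measure.map_apply hm hs, Measure.prod_apply (hm hs), Measure.compProd_apply hs]
  refine lintegral_congr fun v => ?_
  nth_rewrite 1 [← map_quantile (κ v)]
  rw [Measure.map_apply measurable_quantile (measurable_prodMk_left hs)]
  rfl

variable {P : Measure Ω} [IsProbabilityMeasure P] {κ : Kernel β ℝ} [IsMarkovKernel κ] {V : Ω → β}
  {X U : Ω → ℝ}

lemma map_prodMk_prodMk_of_indepFun (hV : Measurable V) (hX : Measurable X) (hU : Measurable U)
    (hκ : P.map (fun ω => (V ω, X ω)) = P.map V ⊗ₘ κ)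
    (hind : IndepFun (fun ω => (V ω, X ω)) U P) (hUlaw : P.map U = unif) :
    P.map (fun ω => (V ω, X ω, U ω)) = P.map V ⊗ₘ (κ ×ₖ Kernel.const β unif) := by
  refine Measure.ext_prod₃ fun {A B C} hA hB hC => ?_
  have hpre : (fun ω => (V ω, X ω, U ω)) ⁻¹' (A ×ˢ B ×ˢ C) =
      (fun ω => (V ω, X ω)) ⁻¹' (A ×ˢ B) ∩ U ⁻¹' C := by
    ext ω
    simp [and_assoc]
  rw [Measure.map_apply (by fun_prop) (hA.prod (hB.prod hC)), hpre,
    hind.measure_inter_preimage_eq_mul _ _ (hA.prod hB) hC,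
    ← Measure.map_apply (hV.prodMk hX) (hA.prod hB), ← Measure.map_apply hU hC, hκ, hUlaw,
    Measure.compProd_apply_prod hA hB, Measure.compProd_apply_prod hA (hB.prod hC),
    ← lintegral_mul_const _ (κ.measurable_coe hB)]
  simp_rw [Kernel.prod_apply_prod, Kernel.const_apply]

lemma map_prodMk_kernelBrockwell (hV : Measurable V) (hX : Measurable X) (hU : Measurable U)
    (hκ : P.map (fun ω => (V ω, X ω)) = P.map V ⊗ₘ κ)
    (hind : IndepFun (fun ω => (V ω, X ω)) U P) (hUlaw : P.map U = unif) :
    P.map (fun ω => (V ω, kernelBrockwell κ V X U ω)) = (P.map V).prod unif := by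
  rw [← map_prodMk_transform_cdf _ κ, ← map_prodMk_prodMk_of_indepFun hV hX hU hκ hind hUlaw,
    Measure.map_map (measurable_fst.prodMk (measurable_transform_kernel κ)) (by fun_prop)]
  rfl

lemma ae_quantile_kernelBrockwell (hV : Measurable V) (hX : Measurable X) (hU : Measurable U)
    (hκ : P.map (fun ω => (V ω, X ω)) = P.map V ⊗ₘ κ)
    (hind : IndepFun (fun ω => (V ω, X ω)) U P) (hUlaw : P.map U = unif) :
    ∀ᵐ ω ∂P, quantile (κ (V ω)) (kernelBrockwell κ V X U ω) = X ω := by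
  have hm : Measurable fun p : β × ℝ × ℝ =>
      quantile (κ p.1) (transform (cdf (κ p.1)) p.2.1 p.2.2) :=
    ((measurable_quantile_kernel κ).comp (measurable_fst.prodMk (measurable_transform_kernel κ)) :)
  have h : ∀ᵐ p ∂P.map (fun ω => (V ω, X ω, U ω)),
      quantile (κ p.1) (transform (cdf (κ p.1)) p.2.1 p.2.2) = p.2.1 := by
    rw [map_prodMk_prodMk_of_indepFun hV hX hU hκ hind hUlaw,
      Measure.ae_compProd_iff (measurableSet_eq_fun hm measurable_snd.fst)]
    filter_upwards with v
    rw [Kernel.prod_apply, Kernel.const_apply]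
    exact ae_quantile_transform_cdf (κ v)
  exact ae_of_ae_map (by fun_prop) h

lemma map_prodMk_eq_compProd_of_quantile (hV : Measurable V) {Z : Ω → ℝ} (hZ : Measurable Z)
    (hVZ : IndepFun V Z P) (hZlaw : P.map Z = unif)
    (hZX : ∀ᵐ ω ∂P, quantile (κ (V ω)) (Z ω) = X ω) :
    P.map (fun ω => (V ω, X ω)) = P.map V ⊗ₘ κ := by
  have h_ae : (fun ω => (V ω, X ω)) =ᵐ[P] fun ω => (V ω, quantile (κ (V ω)) (Z ω)) := by
    filter_upwards [hZX] with ω hω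
    rw [hω]
  rw [Measure.map_congr h_ae, ← map_prodMk_quantile, ← hZlaw,
    ← hVZ.map_prod_eq_prod_map_map hV.aemeasurable hZ.aemeasurable,
    Measure.map_map (measurable_fst.prodMk (measurable_quantile_kernel κ)) (hV.prodMk hZ)]
  rfl

lemma map_kernelBrockwell_and_indepFun (hV : Measurable V) (hX : Measurable X)
    (hU : Measurable U) (hκ : P.map (fun ω => (V ω, X ω)) = P.map V ⊗ₘ κ)
    (hind : IndepFun (fun ω => (V ω, X ω)) U P) (hUlaw : P.map U = unif) :
    P.map (kernelBrockwell κ V X U) = unif ∧ IndepFun V (kernelBrockwell κ V X U) P := by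
  have : IsProbabilityMeasure (P.map V) := Measure.isProbabilityMeasure_map hV.aemeasurable
  exact (map_eq_and_indepFun_of_map_prodMk_eq_prod hV (measurable_kernelBrockwell κ hV hX hU)
    (map_prodMk_kernelBrockwell hV hX hU hκ hind hUlaw)).2

lemma map_prodMk_eq_compProd_prodMkRight_iff {W : Ω → β} {Y : Ω → γ} (hW : Measurable W)
    (hY : Measurable Y) (hX : Measurable X) (hU : Measurable U)
    (hκ : P.map (fun ω => (W ω, X ω)) = P.map W ⊗ₘ κ)
    (hind : IndepFun (fun ω => ((W ω, Y ω), X ω)) U P) (hUlaw : P.map U = unif) :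
    P.map (fun ω => ((W ω, Y ω), X ω)) = P.map (fun ω => (W ω, Y ω)) ⊗ₘ κ.prodMkRight γ ↔
      IndepFun (kernelBrockwell κ W X U) (fun ω => (W ω, Y ω)) P := by
  have hWXU : IndepFun (fun ω => (W ω, X ω)) U P :=
    hind.comp (φ := fun p : (β × γ) × ℝ => (p.1.1, p.2)) (by fun_prop) measurable_id
  constructor
  · intro h
    exact (map_kernelBrockwell_and_indepFun (hW.prodMk hY) hX hU h hind hUlaw).2.symm
  · intro h
    have hZX := ae_quantile_kernelBrockwell hW hX hU hκ hWXU hUlaw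
    exact map_prodMk_eq_compProd_of_quantile (κ := κ.prodMkRight γ) (hW.prodMk hY)
      (measurable_kernelBrockwell κ hW hX hU) h.symm
      (map_kernelBrockwell_and_indepFun hW hX hU hκ hWXU hUlaw).1 hZX

end KernelBrockwell

section ConditionalIndependence

variable {Ω : Type*} [MeasurableSpace Ω] {P : Measure Ω} [IsFiniteMeasure P]

section Disintegration

variable {α β γ : Type*} [MeasurableSpace α] [StandardBorelSpace α] [Nonempty α]
  [MeasurableSpace β] [StandardBorelSpace β] [Nonempty β] [MeasurableSpace γ]
  {X : Ω → α} {Y : Ω → β} {W : Ω → γ}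

lemma map_prodMk_prodMk_apply_prod (hX : Measurable X) (hY : Measurable Y) (hW : Measurable W)
    {A : Set α} {B : Set β} {C : Set γ} (hA : MeasurableSet A) (hB : MeasurableSet B)
    (hC : MeasurableSet C) :
    P.map (fun ω => ((W ω, Y ω), X ω)) ((C ×ˢ B) ×ˢ A) =
      ∫⁻ w in C, condDistrib (fun ω => (X ω, Y ω)) W P w (A ×ˢ B) ∂P.map W := by
  rw [← Measure.compProd_apply_prod hC (hA.prod hB),
    compProd_map_condDistrib (hX.prodMk hY).aemeasurable,
    Measure.map_apply (by fun_prop) ((hC.prod hB).prod hA),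
    Measure.map_apply (by fun_prop) (hC.prod (hA.prod hB))]
  congr 1
  ext ω
  simp only [mem_preimage, mem_prod]
  tauto

lemma compProd_prodMkRight_condDistrib_apply_prod (hY : Measurable Y)
    {A : Set α} {B : Set β} {C : Set γ} (hA : MeasurableSet A) (hB : MeasurableSet B)
    (hC : MeasurableSet C) :
    (P.map (fun ω => (W ω, Y ω)) ⊗ₘ (condDistrib X W P).prodMkRight β) ((C ×ˢ B) ×ˢ A) =
      ∫⁻ w in C, condDistrib X W P w A * condDistrib Y W P w B ∂P.map W := by
  have hm : Measurable fun p : γ × β => condDistrib X W P p.1 A :=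
    (Kernel.measurable_coe _ hA).comp measurable_fst
  rw [Measure.compProd_apply_prod (hC.prod hB) hA, ← compProd_map_condDistrib hY.aemeasurable]
  simp_rw [Kernel.prodMkRight_apply]
  rw [Measure.setLIntegral_compProd hm hC hB]
  simp_rw [setLIntegral_const]

end Disintegration

variable {X Y W : Ω → ℝ}

lemma condIndepGiven_iff_condDistrib_prod_ae_eq (hX : Measurable X) (hY : Measurable Y)
    (hW : Measurable W) : CondIndepGiven P X Y W ↔
      ∀ A B : Set ℝ, MeasurableSet A → MeasurableSet B →
        (fun w => condDistrib (fun ω => (X ω, Y ω)) W P w (A ×ˢ B)) =ᵐ[P.map W]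
          fun w => condDistrib X W P w A * condDistrib Y W P w B := by
  refine forall₂_congr fun A B => forall₂_congr fun hA hB => ?_
  have hprod : Measurable fun w => condDistrib X W P w A * condDistrib Y W P w B :=
    (Kernel.measurable_coe _ hA).mul (Kernel.measurable_coe _ hB)
  rw [EventuallyEq, EventuallyEq, ae_map_iff hW.aemeasurable
    (measurableSet_eq_fun (Kernel.measurable_coe _ (hA.prod hB)) hprod)]
  refine eventually_congr ?_
  filter_upwards [condDistrib_ae_eq_condExp (μ := P) hW (hX.prodMk hY) (hA.prod hB),
    condDistrib_ae_eq_condExp (μ := P) hW hX hA,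
    condDistrib_ae_eq_condExp (μ := P) hW hY hB] with ω hXY_eq hX_eq hY_eq
  rw [mk_preimage_prod] at hXY_eq
  rw [← hXY_eq, ← hX_eq, ← hY_eq, measureReal_def, measureReal_def, measureReal_def,
    ← ENNReal.toReal_mul, ENNReal.toReal_eq_toReal_iff' (measure_ne_top _ _)
      (ENNReal.mul_ne_top (measure_ne_top _ _) (measure_ne_top _ _))]

lemma condIndepGiven_iff_map_eq_compProd (hX : Measurable X) (hY : Measurable Y)
    (hW : Measurable W) : CondIndepGiven P X Y W ↔
      P.map (fun ω => ((W ω, Y ω), X ω)) =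
        P.map (fun ω => (W ω, Y ω)) ⊗ₘ (condDistrib X W P).prodMkRight ℝ := by
  rw [condIndepGiven_iff_condDistrib_prod_ae_eq hX hY hW]
  constructor
  · intro h
    refine Measure.ext_prod₃_iff'.2 fun {C B A} hC hB hA => ?_
    rw [map_prodMk_prodMk_apply_prod hX hY hW hA hB hC,
      compProd_prodMkRight_condDistrib_apply_prod hY hA hB hC]
    exact lintegral_congr_ae (ae_restrict_of_ae (h A B hA hB))
  · intro h A B hA hB
    refine ae_eq_of_forall_setLIntegral_eq_of_sigmaFinite (Kernel.measurable_coe _ (hA.prod hB))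
      ((Kernel.measurable_coe _ hA).mul (Kernel.measurable_coe _ hB)) fun C hC _ => ?_
    rw [← map_prodMk_prodMk_apply_prod hX hY hW hA hB hC, h,
      compProd_prodMkRight_condDistrib_apply_prod hY hA hB hC]

end ConditionalIndependence

lemma map_eq_unif_prod {Ω : Type*} [MeasurableSpace Ω] {P : Measure Ω} {U : Ω → ℝ × ℝ × ℝ}
    (hU : pdf.IsUniform U (Ioo (0 : ℝ) 1 ×ˢ Ioo (0 : ℝ) 1 ×ˢ Ioo (0 : ℝ) 1) P volume) :
    P.map U = unif.prod (unif.prod unif) := by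
  rw [show P.map U = _ from hU, ProbabilityTheory.cond, Measure.volume_eq_prod,
    Measure.volume_eq_prod, Measure.prod_prod, Measure.prod_prod, unif, Measure.prod_restrict,
    Measure.prod_restrict]
  simp

section Joint

variable {Ω : Type*} [MeasurableSpace Ω] {P : Measure Ω} {κ : Kernel ℝ ℝ} [IsMarkovKernel κ]
  {W Y U U' : Ω → ℝ}

lemma measurable_brockwell (hW : Measurable W) (hU' : Measurable U') :
    Measurable (brockwell P W U') :=
  measurable_transform_cdf.comp (hW.prodMk hU')

variable [IsProbabilityMeasure P]

lemma condIndepGiven_iff_indepFun_kernelBrockwell {X : Ω → ℝ} (hX : Measurable X)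
    (hY : Measurable Y) (hW : Measurable W) (hU : Measurable U)
    (hind : IndepFun (fun ω => ((W ω, Y ω), X ω)) U P) (hUlaw : P.map U = unif) :
    CondIndepGiven P X Y W ↔
      IndepFun (kernelBrockwell (condDistrib X W P) W X U) (fun ω => (W ω, Y ω)) P := by
  rw [condIndepGiven_iff_map_eq_compProd hX hY hW]
  exact map_prodMk_eq_compProd_prodMkRight_iff hW hY hX hU
    (compProd_map_condDistrib hX.aemeasurable).symm hind hUlaw

lemma ae_quantile_brockwell (hW : Measurable W) (hU' : Measurable U') (hind : IndepFun W U' P)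
    (hU'law : P.map U' = unif) : ∀ᵐ ω ∂P, quantile (P.map W) (brockwell P W U' ω) = W ω := by
  have : IsProbabilityMeasure (P.map W) := Measure.isProbabilityMeasure_map hW.aemeasurable
  have h := ae_quantile_transform_cdf (P.map W)
  rw [← hU'law, ← hind.map_prod_eq_prod_map_map hW.aemeasurable hU'.aemeasurable] at h
  exact ae_of_ae_map (hW.prodMk hU').aemeasurable h

lemma indepFun_kernelBrockwell_brockwell (hW : Measurable W) (hY : Measurable Y)
    (hU : Measurable U) (hU' : Measurable U')
    (hκ : P.map (fun ω => (W ω, Y ω)) = P.map W ⊗ₘ κ)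
    (hind : IndepFun (fun ω => (W ω, Y ω)) (fun ω => (U ω, U' ω)) P)
    (hUU' : IndepFun U U' P) (hUlaw : P.map U = unif) :
    IndepFun (kernelBrockwell κ W Y U) (brockwell P W U') P := by
  have hZ : Measurable (kernelBrockwell κ W Y U) := measurable_kernelBrockwell κ hW hY hU
  have hZW : IndepFun (kernelBrockwell κ W Y U) W P :=
    (map_kernelBrockwell_and_indepFun hW hY hU hκ (hind.comp measurable_id measurable_fst)
      hUlaw).2.symm
  have hU'ind : IndepFun U' (fun ω => (U ω, W ω, Y ω)) P :=
    indepFun_prodMk_right hU' hU (hW.prodMk hY) hUU'.symm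
      (hind.symm.comp measurable_swap measurable_id)
  have hm : Measurable fun p : ℝ × ℝ × ℝ => (transform (cdf (κ p.2.1)) p.2.2 p.1, p.2.1) :=
    ((measurable_transform_kernel κ).comp (by fun_prop :
      Measurable fun p : ℝ × ℝ × ℝ => (p.2.1, p.2.2, p.1))).prodMk measurable_snd.fst
  have hZWU' : IndepFun (fun ω => (kernelBrockwell κ W Y U ω, W ω)) U' P :=
    (hU'ind.comp measurable_id hm).symm
  exact (indepFun_prodMk_right hZ hW hU' hZW hZWU').comp measurable_id measurable_transform_cdf

lemma indepFun_prodMk_kernelBrockwell_brockwell_iff {α : Type*} [MeasurableSpace α] {Z : Ω → α}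
    (hZ : Measurable Z) (hW : Measurable W) (hY : Measurable Y) (hU : Measurable U)
    (hU' : Measurable U') (hκ : P.map (fun ω => (W ω, Y ω)) = P.map W ⊗ₘ κ)
    (hind : IndepFun (fun ω => (Z ω, W ω, Y ω)) (fun ω => (U ω, U' ω)) P)
    (hUlaw : P.map U = unif) (hU'law : P.map U' = unif) :
    IndepFun Z (fun ω => (kernelBrockwell κ W Y U ω, brockwell P W U' ω)) P ↔
      IndepFun Z (fun ω => (W ω, Y ω)) P := by
  have : IsProbabilityMeasure (P.map W) := Measure.isProbabilityMeasure_map hW.aemeasurable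
  have hWYU : IndepFun (fun ω => (W ω, Y ω)) U P := hind.comp measurable_snd measurable_fst
  have hWU' : IndepFun W U' P := hind.comp measurable_snd.fst measurable_snd
  let f : (ℝ × ℝ) × ℝ × ℝ → ℝ × ℝ := fun p =>
    (transform (cdf (κ p.1.1)) p.1.2 p.2.1, transform (cdf (P.map W)) p.1.1 p.2.2)
  let g : ℝ × ℝ → ℝ × ℝ := fun z =>
    (quantile (P.map W) z.2, quantile (κ (quantile (P.map W) z.2)) z.1)
  have hf₁ := (measurable_transform_kernel κ).comp (by fun_prop :
    Measurable fun p : (ℝ × ℝ) × ℝ × ℝ => (p.1.1, p.1.2, p.2.1))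
  have hf₂ := (measurable_transform_cdf (ν := P.map W)).comp (by fun_prop :
    Measurable fun p : (ℝ × ℝ) × ℝ × ℝ => (p.1.1, p.2.2))
  have hg₁ : Measurable fun z : ℝ × ℝ => quantile (P.map W) z.2 :=
    measurable_quantile.comp measurable_snd
  have hg₂ := (measurable_quantile_kernel κ).comp (hg₁.prodMk measurable_fst)
  have hf : Measurable f := hf₁.prodMk hf₂
  have hg : Measurable g := hg₁.prodMk hg₂
  refine indepFun_randomization_iff hZ (hW.prodMk hY) (hU.prodMk hU') hf hg hind ?_
  filter_upwards [ae_quantile_brockwell hW hU' hWU' hU'law,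
    ae_quantile_kernelBrockwell hW hY hU hκ hWYU hUlaw] with ω hωW hωY
  calc g (f ((W ω, Y ω), U ω, U' ω))
      = (quantile (P.map W) (brockwell P W U' ω),
          quantile (κ (quantile (P.map W) (brockwell P W U' ω))) (kernelBrockwell κ W Y U ω)) := rfl
    _ = (W ω, Y ω) := by rw [hωW, hωY]

lemma iIndepFun_kernelBrockwell_iff {X₁ X₂ X₃ U₁ U₂ U₃ : Ω → ℝ}
    (hX₁ : Measurable X₁) (hX₂ : Measurable X₂) (hX₃ : Measurable X₃)
    (hU₁ : Measurable U₁) (hU₂ : Measurable U₂) (hU₃ : Measurable U₃)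
    (hXU : IndepFun (fun ω => (X₁ ω, X₂ ω, X₃ ω)) (fun ω => (U₁ ω, U₂ ω, U₃ ω)) P)
    (hU : P.map (fun ω => (U₁ ω, U₂ ω, U₃ ω)) = unif.prod (unif.prod unif)) :
    iIndepFun ![kernelBrockwell (condDistrib X₁ X₃ P) X₃ X₁ U₁,
      kernelBrockwell (condDistrib X₂ X₃ P) X₃ X₂ U₂, brockwell P X₃ U₃] P ↔
        CondIndepGiven P X₁ X₂ X₃ := by
  set Z₁ := kernelBrockwell (condDistrib X₁ X₃ P) X₃ X₁ U₁
  obtain ⟨hU₁law, hU₂₃law, hU₁₂₃⟩ :=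
    map_eq_and_indepFun_of_map_prodMk_eq_prod hU₁ (hU₂.prodMk hU₃) hU
  obtain ⟨hU₂law, hU₃law, hU₂₃⟩ := map_eq_and_indepFun_of_map_prodMk_eq_prod hU₂ hU₃ hU₂₃law
  have hκ₂ : P.map (fun ω => (X₃ ω, X₂ ω)) = P.map X₃ ⊗ₘ condDistrib X₂ X₃ P :=
    (compProd_map_condDistrib hX₂.aemeasurable).symm
  have hZ₁ : Measurable Z₁ := measurable_kernelBrockwell _ hX₃ hX₁ hU₁
  have hXU₁ : IndepFun (fun ω => ((X₃ ω, X₂ ω), X₁ ω)) U₁ P :=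
    hXU.comp (φ := fun x : ℝ × ℝ × ℝ => ((x.2.2, x.2.1), x.1)) (by fun_prop) measurable_fst
  have hU₂₃X : IndepFun (fun ω => (U₂ ω, U₃ ω)) (fun ω => (U₁ ω, X₁ ω, X₂ ω, X₃ ω)) P :=
    indepFun_prodMk_right (hU₂.prodMk hU₃) hU₁ (hX₁.prodMk (hX₂.prodMk hX₃)) hU₁₂₃.symm
      (hXU.symm.comp (measurable_snd.prodMk measurable_fst) measurable_id)
  have hT := (measurable_transform_kernel (condDistrib X₁ X₃ P)).comp (by fun_prop :
    Measurable fun p : ℝ × ℝ × ℝ × ℝ => (p.2.2.2, p.2.1, p.1))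
  have hZ₁X : IndepFun (fun ω => (Z₁ ω, X₃ ω, X₂ ω)) (fun ω => (U₂ ω, U₃ ω)) P :=
    (hU₂₃X.comp measurable_id (hT.prodMk (by fun_prop :
      Measurable fun p : ℝ × ℝ × ℝ × ℝ => (p.2.2.2, p.2.2.1)))).symm
  have hZ₂₃ : IndepFun (kernelBrockwell (condDistrib X₂ X₃ P) X₃ X₂ U₂) (brockwell P X₃ U₃) P :=
    indepFun_kernelBrockwell_brockwell hX₃ hX₂ hU₂ hU₃ hκ₂
      (hZ₁X.comp measurable_snd measurable_id) hU₂₃ hU₂law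
  rw [iIndepFun_vec_three_iff hZ₁ (measurable_kernelBrockwell _ hX₃ hX₂ hU₂)
      (measurable_brockwell hX₃ hU₃), and_iff_left hZ₂₃,
    indepFun_prodMk_kernelBrockwell_brockwell_iff hZ₁ hX₃ hX₂ hU₂ hU₃ hκ₂ hZ₁X hU₂law hU₃law,
    condIndepGiven_iff_indepFun_kernelBrockwell hX₁ hX₂ hX₃ hU₁ hXU₁ hU₁law]

lemma IsCondDistFun.condBrockwell_ae_eq {X Y : Ω → ℝ} {F : ℝ → ℝ → ℝ}
    (hF : IsCondDistFun P X Y F) (hY : Measurable Y) (U : Ω → ℝ) :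
    condBrockwell F X Y U =ᵐ[P] kernelBrockwell (condDistrib X Y P) Y X U := by
  filter_upwards [ae_of_ae_map hY.aemeasurable hF] with ω hω
  rw [condBrockwell, kernelBrockwell, funext hω]

end Joint

end Brockwell

end

theorem corollary2_general {Ω : Type*} [MeasurableSpace Ω] (P : Measure Ω) [IsProbabilityMeasure P]
    (X₁ X₂ X₃ U₁ U₂ U₃ : Ω → ℝ)
    (hX₁ : Measurable X₁) (hX₂ : Measurable X₂) (hX₃ : Measurable X₃)
    (hU₁ : Measurable U₁) (hU₂ : Measurable U₂) (hU₃ : Measurable U₃)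
    (hXU : IndepFun (fun ω => (X₁ ω, X₂ ω, X₃ ω)) (fun ω => (U₁ ω, U₂ ω, U₃ ω)) P)
    (hU : pdf.IsUniform (fun ω => (U₁ ω, U₂ ω, U₃ ω))
      (Ioo (0 : ℝ) 1 ×ˢ Ioo (0 : ℝ) 1 ×ˢ Ioo (0 : ℝ) 1) P volume)
    (F₁₃ F₂₃ : ℝ → ℝ → ℝ)
    (hF₁₃ : Brockwell.IsCondDistFun P X₁ X₃ F₁₃)
    (hF₂₃ : Brockwell.IsCondDistFun P X₂ X₃ F₂₃) :
    Brockwell.CondIndepGiven P X₁ X₂ X₃ ↔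
      iIndepFun ![Brockwell.condBrockwell F₁₃ X₁ X₃ U₁, Brockwell.condBrockwell F₂₃ X₂ X₃ U₂,
        Brockwell.brockwell P X₃ U₃] P := by
  rw [← Brockwell.iIndepFun_kernelBrockwell_iff hX₁ hX₂ hX₃ hU₁ hU₂ hU₃ hXU
    (Brockwell.map_eq_unif_prod hU)]
  refine iIndepFun_congr fun i => ?_
  fin_cases i
  · exact (hF₁₃.condBrockwell_ae_eq hX₃ U₁).symm
  · exact (hF₂₃.condBrockwell_ae_eq hX₃ U₂).symm
  · exact Filter.EventuallyEq.rfl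

theorem corollary2 {Ω : Type*} [MeasurableSpace Ω] (P : Measure Ω) [IsProbabilityMeasure P]
    (X₁ X₂ X₃ U₁ U₂ U₃ : Ω → ℝ)
    (hX₁ : Measurable X₁) (hX₂ : Measurable X₂) (hX₃ : Measurable X₃)
    (hU₁ : Measurable U₁) (hU₂ : Measurable U₂) (hU₃ : Measurable U₃)
    (hXU : IndepFun (fun ω => (X₁ ω, X₂ ω, X₃ ω)) (fun ω => (U₁ ω, U₂ ω, U₃ ω)) P)
    (hU : pdf.IsUniform (fun ω => (U₁ ω, U₂ ω, U₃ ω))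
      (Ioo (0 : ℝ) 1 ×ˢ Ioo (0 : ℝ) 1 ×ˢ Ioo (0 : ℝ) 1) P volume)
    (F₁₃ F₂₃ : ℝ → ℝ → ℝ)
    (hF₁₃ : Brockwell.IsCondDistFun P X₁ X₃ F₁₃)
    (hF₂₃ : Brockwell.IsCondDistFun P X₂ X₃ F₂₃)
    (hm₁ : Measurable (fun p : ℝ × ℝ => F₁₃ p.1 p.2))
    (hm₁' : Measurable (fun p : ℝ × ℝ => Brockwell.leftLimit (fun x => F₁₃ x p.2) p.1))
    (hm₂ : Measurable (fun p : ℝ × ℝ => F₂₃ p.1 p.2))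
    (hm₂' : Measurable (fun p : ℝ × ℝ => Brockwell.leftLimit (fun x => F₂₃ x p.2) p.1)) :
    (Brockwell.CondIndepGiven P X₁ X₂ X₃ →
      iIndepFun ![Brockwell.condBrockwell F₁₃ X₁ X₃ U₁, Brockwell.condBrockwell F₂₃ X₂ X₃ U₂,
        Brockwell.brockwell P X₃ U₃] P) ∧
    ((∀ᵐ x ∂(P.map X₃), Brockwell.WellOrderingCondition (fun t => F₁₃ t x) ∧
        Brockwell.WellOrderingCondition (fun t => F₂₃ t x)) →
      Brockwell.WellOrderingCondition (Brockwell.distFun P X₃) →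
      iIndepFun ![Brockwell.condBrockwell F₁₃ X₁ X₃ U₁, Brockwell.condBrockwell F₂₃ X₂ X₃ U₂,
        Brockwell.brockwell P X₃ U₃] P →
      Brockwell.CondIndepGiven P X₁ X₂ X₃) := by
  have h := corollary2_general P X₁ X₂ X₃ U₁ U₂ U₃ hX₁ hX₂ hX₃ hU₁ hU₂ hU₃ hXU hU F₁₃ F₂₃ hF₁₃ hF₂₃
  exact ⟨h.1, fun _ _ => h.2⟩
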